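/- Let $k$ be a field of characteristic zero. **Trees.** All trees are planar binary trees; nodes are internal nodes, $|t|$ is the number of nodes of $t$, nodes are indexed from left to right, and the nodes are partially ordered with the root maximal (descendants are smaller). An *ordered tree* is a tree $t$ with a bijective labelling of its nodes by $1,\dots,|t|$ that is a linear extension of this order; reading labels from left to right identifies ordered trees with permutations $\sigma=\sigma_1\cdots\sigma_n$, $n\ge 0$. A *bi-leveled tree* is a tree with some of its nodes circled so that the leftmost node (if there is a node) is circled and has no circled children, and the parent of a circled node is circled. The map $\tau$ sends an ordered tree to its underlying tree, $\beta$ sends an ordered tree $\sigma$ to its underlying tree with exactly the nodes with $\sigma_i\ge\sigma_1$ circled, and $\phi$ sends a bi-leveled tree to its underlying tree. Let $\mathfrak{S}Sym$ and $\mathcal{Y}Sym$ be the $k$-vector spaces with bases $\{F_\sigma\}$ ($\sigma$ an ordered tree) and $\{F_t\}$ ($t$ a tree), let $\mathcal{M}Sym$ be the $k$-vector space with basis $\{F_b\}$ ($b$ a bi-leveled tree, $|b|\ge1$), and let $\mathcal{M}Sym^{+}=k\,F_{\emptyset}\oplus\mathcal{M}Sym$ be the space obtained by putting $\mathcal{M}Sym_0:=k$,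 where $\emptyset$ is the tree without nodes. Let $\boldsymbol\tau:\mathfrak{S}Sym\to\mathcal{Y}Sym$, $\boldsymbol\beta:\mathfrak{S}Sym\to\mathcal{M}Sym^{+}$ and $\boldsymbol\phi:\mathcal{M}Sym^{+}\to\mathcal{Y}Sym$ be the linear maps induced by $\tau,\beta,\phi$ on these bases. **Structure maps.** A *$p$-splitting* $t\to(t_0,\dots,t_p)$ is obtained by choosing $p$ leaves of $t$, repetitions allowed, and splitting $t$ along the paths from these leaves down to the root; labels and circles of nodes are kept. For a tree $s$ with $p$ nodes, $(t_0,\dots,t_p)/s$ is the tree obtained by grafting the roots of $t_0,\dots,t_p$ onto the leaves of $s$ from left to right. For ordered trees $t,s$ with $q$ and $p$ nodes put $$F_t\cdot F_s=\sum_{t\to(t_0,\dots,t_p)}F_{(t_0,\dots,t_p)/s},$$ where the labels of $s$ are incremented by $q$. This is the product of $\mathfrak{S}Sym$; its unit is $F_\emptyset$. For an ordered tree $w$ and a bi-leveled tree $s$ with $p$ nodes put, with $b=\beta(w)$, $$F_w\cdot F_s=\sum_{b\to(b_0,\dots,b_p)}F_{(b_0,\dots,b_p)/s},$$ where in $(b_0,\dots,b_p)/s$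 every node originating in $s$ is circled and the nodes of the $b_i$ keep their circles if $|b_0|>0$, while otherwise every node originating in $b$ is uncircled and the nodes of $s$ keep their circles. Extend these rules bilinearly. For a section $g$ of $\beta$ (a map from bi-leveled trees to ordered trees with $\beta\circ g=\mathrm{id}$) define a product on $\mathcal{M}Sym^{+}$ by bilinear extension of $F_a\cdot F_b:=F_{g(a)}\cdot F_b$. **Theorem.** 1. The action of $\mathfrak{S}Sym$ maps $\mathcal{M}Sym$ to itself. It is associative and unital on $\mathcal{M}Sym^{+}$, hence on $\mathcal{M}Sym$: $(x\cdot y)\cdot m=x\cdot(y\cdot m)$ and $F_\emptyset\cdot m=m$ for all $x,y\in\mathfrak{S}Sym$ and $m\in\mathcal{M}Sym^{+}$. 2. The map $\beta$ has a section, all sections of $\beta$ induce the same product on $\mathcal{M}Sym^{+}$, the subspace $\mathcal{M}Sym$ is closed under this product, and the product is associative on $\mathcal{M}Sym^{+}$, hence on $\mathcal{M}Sym$, with unit $F_\emptyset$. 3. For this product, $\boldsymbol\beta:\mathfrak{S}Sym\to\mathcal{M}Sym^{+}$ is an algebra map: $\boldsymbol\beta(F_\emptyset)=F_\emptyset$ and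 $\boldsymbol\beta(x\cdot y)=\boldsymbol\beta(x)\cdot\boldsymbol\beta(y)$ for all $x,y\in\mathfrak{S}Sym$. Moreover $\boldsymbol\phi\circ\boldsymbol\beta=\boldsymbol\tau$. -/

import Mathlib

open BinaryTree

noncomputable section

namespace MSymDefs

/-! ### Planar binary trees with decorated internal nodes

`BinaryTree α` is the type of planar binary trees whose internal nodes carry a decoration in `α`.
Undecorated planar binary trees are `BinaryTree Unit`. The constructor `nil` is the tree that
consists of a single leaf, that is, the unique tree without internal nodes. -/

/-- The decorations of the nodes, listed from left to right (in-order). -/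
def inorder {α : Type*} : BinaryTree α → List α
  | nil => []
  | node a l r => inorder l ++ a :: inorder r

/-- Splitting a tree at its `i`-th leaf (leaves are numbered `0, …, n` from left to right): the leaf
and all branchings between it and the root are cut in two. The left piece receives
the first `i` nodes in the left-to-right order, the right piece receives the others. -/
def cut {α : Type*} : BinaryTree α → ℕ → BinaryTree α × BinaryTree α
  | nil, _ => (nil, nil)
  | node a l r, i =>
    if i ≤ l.numNodes then ((cut l i).1, node a (cut l i).2 r)
    else (node a l (cut r (i - l.numNodes - 1)).1, (cut r (i - l.numNodes - 1)).2)

/-- The list of all `p`-splittings of `t`, one for each choice of `p` leaves of `t` with repetitions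
allowed. The leftmost chosen leaf cuts off the first tree; the other chosen leaves (which lie weakly
to its right) are leaves of the remaining piece and split it further.
Every entry is a forest of `p + 1` trees. -/
def splittings {α : Type*} : ℕ → BinaryTree α → List (List (BinaryTree α))
  | 0, t => [[t]]
  | p + 1, t => (List.range (t.numNodes + 1)).flatMap fun i =>
      (splittings p (cut t i).2).map fun f => (cut t i).1 :: f

/-- `graft f s` is the tree `(t₀, …, t_p)/s` obtained by grafting the roots of the trees of the
forest `f = [t₀, …, t_p]` onto the leaves of `s`, from left to right (`p` is the number of nodes
of `s`). -/
def graft {α : Type*} : List (BinaryTree α) → BinaryTree α → BinaryTree α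
  | f, nil => f.headD nil
  | f, node a l r => node a (graft (f.take (l.numNodes + 1)) l) (graft (f.drop (l.numNodes + 1)) r)

/-! ### Ordered trees -/

/-- Every label is larger than all labels of the descendants of its node (the root is maximal). -/
def Decreasing : BinaryTree ℕ → Prop
  | nil => True
  | node a l r => (∀ x ∈ inorder l, x < a) ∧ (∀ x ∈ inorder r, x < a) ∧ Decreasing l ∧ Decreasing r

/-- The labels are `1, …, n`, each used once, and they form a linear extension of the
poset of nodes in which the root is maximal. -/
def IsOrdered (t : BinaryTree ℕ) : Prop :=
  Decreasing t ∧ (inorder t).Perm (List.range' 1 t.numNodes)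

/-- Ordered trees, that is, permutations: reading the labels of an ordered tree from left to right
gives the one-line notation of the corresponding permutation. -/
abbrev OrderedTree : Type := {t : BinaryTree ℕ // IsOrdered t}

/-! ### Bi-leveled trees -/

/-- The circled nodes (those decorated by `true`) form an upper set: a node with a circled
descendant is circled. -/
def UpClosed : BinaryTree Bool → Prop
  | nil => True
  | node c l r =>
    (true ∈ inorder l → c = true) ∧ (true ∈ inorder r → c = true) ∧ UpClosed l ∧ UpClosed r

/-- The leftmost node, if there is one, is circled and none of its descendants is. -/
def LeftmostMinimal : BinaryTree Bool → Prop
  | nil => True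
  | node c nil r => c = true ∧ true ∉ inorder r
  | node _ l _ => LeftmostMinimal l

/-- The rules for the circled nodes of a bi-leveled tree. -/
def IsBiLeveled (t : BinaryTree Bool) : Prop := UpClosed t ∧ LeftmostMinimal t

/-- Bi-leveled trees, including the one without nodes. -/
abbrev BiTree : Type := {t : BinaryTree Bool // IsBiLeveled t}

/-! ### Auxiliary facts: the constructions below yield ordered and bi-leveled trees -/

section Aux

variable {α β : Type*}

lemma length_inorder (t : BinaryTree α) : (inorder t).length = t.numNodes := by
  induction t with
  | nil => rfl
  | node a l r hl hr => simp [inorder, hl, hr]; omega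

lemma inorder_map (g : α → β) (t : BinaryTree α) : inorder (t.map g) = (inorder t).map g := by
  induction t with
  | nil => rfl
  | node a l r hl hr => simp [inorder, BinaryTree.map, hl, hr]

lemma numNodes_map (g : α → β) (t : BinaryTree α) : (t.map g).numNodes = t.numNodes := by
  rw [← length_inorder, inorder_map, List.length_map, length_inorder]

lemma eq_nil_of_inorder {t : BinaryTree α} (h : inorder t = []) : t = nil := by
  cases t with
  | nil => rfl
  | node a l r => simp [inorder] at h

lemma inorder_cut (t : BinaryTree α) (i : ℕ) :
    inorder (cut t i).1 ++ inorder (cut t i).2 = inorder t := by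
  induction t generalizing i with
  | nil => rfl
  | node a l r hl hr =>
    by_cases h : i ≤ l.numNodes
    · have := hl i
      simp [cut, h, inorder, ← this]
    · have := hr (i - l.numNodes - 1)
      simp [cut, h, inorder, ← this]

lemma length_of_mem_splittings {p : ℕ} {t : BinaryTree α} {f : List (BinaryTree α)}
    (h : f ∈ splittings p t) : f.length = p + 1 := by
  induction p generalizing t f with
  | zero => simp [splittings] at h; simp [h]
  | succ p ih =>
    simp only [splittings, List.mem_flatMap, List.mem_map] at h
    obtain ⟨i, -, f', hf', rfl⟩ := h
    simp [ih hf']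

lemma inorder_of_mem_splittings {p : ℕ} {t : BinaryTree α} {f : List (BinaryTree α)}
    (h : f ∈ splittings p t) : f.flatMap inorder = inorder t := by
  induction p generalizing t f with
  | zero => simp [splittings] at h; simp [h]
  | succ p ih =>
    simp only [splittings, List.mem_flatMap, List.mem_map] at h
    obtain ⟨i, -, f', hf', rfl⟩ := h
    simp [ih hf', inorder_cut]

lemma inorder_graft_perm (s : BinaryTree α) (f : List (BinaryTree α))
    (h : f.length = s.numNodes + 1) :
    (inorder (graft f s)).Perm (inorder s ++ f.flatMap inorder) := by
  induction s generalizing f with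
  | nil =>
    match f, h with
    | [t], _ => simp [graft, inorder]
  | node a l r hl hr =>
    simp only [numNodes] at h
    have h1 := hl (f.take (l.numNodes + 1)) (by simp; omega)
    have h2 := hr (f.drop (l.numNodes + 1)) (by simp; omega)
    have h3 : f.flatMap inorder = (f.take (l.numNodes + 1)).flatMap inorder ++
        (f.drop (l.numNodes + 1)).flatMap inorder := by
      rw [← List.flatMap_append, List.take_append_drop]
    rw [h3]
    simp only [graft, inorder]
    refine (h1.append (h2.cons a)).trans ?_
    rw [← Multiset.coe_eq_coe]
    simp only [← Multiset.coe_add, ← Multiset.cons_coe, ← Multiset.singleton_add]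
    abel

lemma decreasing_cut {t : BinaryTree ℕ} (h : Decreasing t) (i : ℕ) :
    Decreasing (cut t i).1 ∧ Decreasing (cut t i).2 := by
  induction t generalizing i with
  | nil => exact ⟨h, h⟩
  | node a l r hl hr =>
    obtain ⟨h1, h2, h3, h4⟩ := h
    by_cases hi : i ≤ l.numNodes
    · have e := inorder_cut l i
      simp only [cut, hi, if_true]
      exact ⟨(hl h3 i).1, fun x hx => h1 x (by rw [← e]; exact List.mem_append_right _ hx), h2,
        (hl h3 i).2, h4⟩
    · have e := inorder_cut r (i - l.numNodes - 1)
      simp only [cut, hi, if_false]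
      exact ⟨⟨h1, fun x hx => h2 x (by rw [← e]; exact List.mem_append_left _ hx), h3,
        (hr h4 _).1⟩, (hr h4 _).2⟩

lemma decreasing_of_mem_splittings {p : ℕ} {t : BinaryTree ℕ} {f : List (BinaryTree ℕ)}
    (ht : Decreasing t) (h : f ∈ splittings p t) : ∀ u ∈ f, Decreasing u := by
  induction p generalizing t f with
  | zero => simp [splittings] at h; simp [h, ht]
  | succ p ih =>
    simp only [splittings, List.mem_flatMap, List.mem_map] at h
    obtain ⟨i, -, f', hf', rfl⟩ := h
    simp only [List.mem_cons, forall_eq_or_imp]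
    exact ⟨(decreasing_cut ht i).1, ih (decreasing_cut ht i).2 hf'⟩

lemma decreasing_graft {s : BinaryTree ℕ} (hs : Decreasing s) (f : List (BinaryTree ℕ))
    (h : f.length = s.numNodes + 1) (hf : ∀ u ∈ f, Decreasing u)
    (hlt : ∀ x ∈ inorder s, ∀ u ∈ f, ∀ y ∈ inorder u, y < x) : Decreasing (graft f s) := by
  induction s generalizing f with
  | nil =>
    match f, h with
    | [t], _ => simpa [graft] using hf
  | node a l r hl hr =>
    obtain ⟨h1, h2, h3, h4⟩ := hs
    simp only [numNodes] at h
    have ht : (f.take (l.numNodes + 1)).length = l.numNodes + 1 := by simp; omega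
    have hd : (f.drop (l.numNodes + 1)).length = r.numNodes + 1 := by simp; omega
    simp only [inorder, List.mem_append, List.mem_cons] at hlt
    refine ⟨fun x hx => ?_, fun x hx => ?_, hl h3 _ ht (fun u hu => hf u (List.mem_of_mem_take hu))
      (fun x hx u hu => hlt x (Or.inl hx) u (List.mem_of_mem_take hu)),
      hr h4 _ hd (fun u hu => hf u (List.mem_of_mem_drop hu))
      (fun x hx u hu => hlt x (Or.inr (Or.inr hx)) u (List.mem_of_mem_drop hu))⟩
    · have := (inorder_graft_perm _ _ ht).mem_iff.1 hx
      rcases List.mem_append.1 this with hx | hx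
      · exact h1 x hx
      · obtain ⟨u, hu, hxu⟩ := List.mem_flatMap.1 hx
        exact hlt a (Or.inr (Or.inl rfl)) u (List.mem_of_mem_take hu) x hxu
    · have := (inorder_graft_perm _ _ hd).mem_iff.1 hx
      rcases List.mem_append.1 this with hx | hx
      · exact h2 x hx
      · obtain ⟨u, hu, hxu⟩ := List.mem_flatMap.1 hx
        exact hlt a (Or.inr (Or.inl rfl)) u (List.mem_of_mem_drop hu) x hxu

lemma decreasing_shift {t : BinaryTree ℕ} (h : Decreasing t) (q : ℕ) :
    Decreasing (t.map (· + q)) := by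
  induction t with
  | nil => trivial
  | node a l r hl hr =>
    obtain ⟨h1, h2, h3, h4⟩ := h
    refine ⟨?_, ?_, hl h3, hr h4⟩
    · intro x hx
      rw [inorder_map, List.mem_map] at hx
      obtain ⟨y, hy, rfl⟩ := hx
      exact Nat.add_lt_add_right (h1 y hy) q
    · intro x hx
      rw [inorder_map, List.mem_map] at hx
      obtain ⟨y, hy, rfl⟩ := hx
      exact Nat.add_lt_add_right (h2 y hy) q

lemma numNodes_graft (s : BinaryTree α) (f : List (BinaryTree α))
    (h : f.length = s.numNodes + 1) :
    (graft f s).numNodes = s.numNodes + (f.flatMap inorder).length := by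
  rw [← length_inorder, (inorder_graft_perm s f h).length_eq, List.length_append, length_inorder]

lemma isOrdered_graft (t s : OrderedTree) {f : List (BinaryTree ℕ)}
    (hf : f ∈ splittings s.1.numNodes t.1) :
    IsOrdered (graft f (s.1.map (· + t.1.numNodes))) := by
  have hlen : f.length = (s.1.map (· + t.1.numNodes)).numNodes + 1 := by
    rw [numNodes_map, length_of_mem_splittings hf]
  have hin := inorder_of_mem_splittings hf
  refine ⟨decreasing_graft (decreasing_shift s.2.1 _) f hlen
    (decreasing_of_mem_splittings t.2.1 hf) ?_, ?_⟩
  · intro x hx u hu y hy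
    have hy' : y ∈ inorder t.1 := by
      rw [← hin]
      exact List.mem_flatMap.2 ⟨u, hu, hy⟩
    have hy2 := t.2.2.mem_iff.1 hy'
    rw [inorder_map, List.mem_map] at hx
    obtain ⟨z, hz, rfl⟩ := hx
    have hz2 := s.2.2.mem_iff.1 hz
    simp only [List.mem_range'_1] at hy2 hz2
    omega
  · rw [numNodes_graft _ _ hlen, hin, length_inorder, numNodes_map]
    refine (inorder_graft_perm _ _ hlen).trans ?_
    rw [hin, inorder_map, add_comm s.1.numNodes, ← List.range'_append_1]
    refine List.perm_append_comm.trans (t.2.2.append ?_)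
    refine (s.2.2.map _).trans ?_
    rw [show (fun x => x + t.1.numNodes) = (fun x => t.1.numNodes + x) from
      funext fun x => add_comm _ _, List.map_add_range', add_comm 1]

lemma upClosed_cut {t : BinaryTree Bool} (h : UpClosed t) (i : ℕ) :
    UpClosed (cut t i).1 ∧ UpClosed (cut t i).2 := by
  induction t generalizing i with
  | nil => exact ⟨h, h⟩
  | node a l r hl hr =>
    obtain ⟨h1, h2, h3, h4⟩ := h
    by_cases hi : i ≤ l.numNodes
    · have e := inorder_cut l i
      simp only [cut, hi, if_true]
      exact ⟨(hl h3 i).1, fun hx => h1 (by rw [← e]; exact List.mem_append_right _ hx), h2,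
        (hl h3 i).2, h4⟩
    · have e := inorder_cut r (i - l.numNodes - 1)
      simp only [cut, hi, if_false]
      exact ⟨⟨h1, fun hx => h2 (by rw [← e]; exact List.mem_append_left _ hx), h3,
        (hr h4 _).1⟩, (hr h4 _).2⟩

lemma upClosed_of_mem_splittings {p : ℕ} {t : BinaryTree Bool} {f : List (BinaryTree Bool)}
    (ht : UpClosed t) (h : f ∈ splittings p t) : ∀ u ∈ f, UpClosed u := by
  induction p generalizing t f with
  | zero => simp [splittings] at h; simp [h, ht]
  | succ p ih =>
    simp only [splittings, List.mem_flatMap, List.mem_map] at h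
    obtain ⟨i, -, f', hf', rfl⟩ := h
    simp only [List.mem_cons, forall_eq_or_imp]
    exact ⟨(upClosed_cut ht i).1, ih (upClosed_cut ht i).2 hf'⟩

lemma leftmostMinimal_node {c : Bool} {l r : BinaryTree Bool} (hl : l ≠ nil) :
    LeftmostMinimal (node c l r) ↔ LeftmostMinimal l := by
  cases l with
  | nil => exact absurd rfl hl
  | node a l' r' => rfl

lemma leftmostMinimal_cut {t : BinaryTree Bool} (h : LeftmostMinimal t) (i : ℕ) :
    LeftmostMinimal (cut t i).1 := by
  induction t generalizing i with
  | nil => exact h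
  | node a l r hl hr =>
    by_cases hn : l = nil
    · subst hn
      obtain ⟨h1, h2⟩ := h
      by_cases hi : i ≤ (nil : BinaryTree Bool).numNodes
      · simp only [cut, hi, if_true]
        trivial
      · simp only [cut, hi, if_false]
        have e := inorder_cut r (i - (nil : BinaryTree Bool).numNodes - 1)
        exact ⟨h1, fun hx => h2 (by rw [← e]; exact List.mem_append_left _ hx)⟩
    · have h' := (leftmostMinimal_node hn).1 h
      by_cases hi : i ≤ l.numNodes
      · simp only [cut, hi, if_true]
        exact hl h' i
      · simp only [cut, hi, if_false]
        exact (leftmostMinimal_node hn).2 h'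

lemma leftmostMinimal_of_mem_splittings {p : ℕ} {t : BinaryTree Bool}
    {f : List (BinaryTree Bool)} (ht : LeftmostMinimal t) (h : f ∈ splittings p t) :
    LeftmostMinimal (f.headD nil) := by
  cases p with
  | zero => simp [splittings] at h; simp [h, ht]
  | succ p =>
    simp only [splittings, List.mem_flatMap, List.mem_map] at h
    obtain ⟨i, -, f', hf', rfl⟩ := h
    exact leftmostMinimal_cut ht i

lemma headD_take (f : List (BinaryTree α)) (n : ℕ) :
    (f.take (n + 1)).headD nil = f.headD nil := by
  cases f <;> rfl

lemma graft_ne_nil {s : BinaryTree α} {f : List (BinaryTree α)} (h : f.headD nil ≠ nil) :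
    graft f s ≠ nil := by
  cases s with
  | nil => exact h
  | node a l r => simp [graft]

lemma leftmostMinimal_graft {s : BinaryTree Bool} {f : List (BinaryTree Bool)}
    (h : f.headD nil ≠ nil) (hf : LeftmostMinimal (f.headD nil)) :
    LeftmostMinimal (graft f s) := by
  induction s generalizing f with
  | nil => exact hf
  | node a l r hl hr =>
    have e := headD_take f l.numNodes
    simp only [graft]
    rw [leftmostMinimal_node (graft_ne_nil (by rwa [e]))]
    exact hl (by rwa [e]) (by rwa [e])

lemma upClosed_graft_of_forall {s : BinaryTree Bool} (f : List (BinaryTree Bool))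
    (h : f.length = s.numNodes + 1) (hs : ∀ x ∈ inorder s, x = true) (hf : ∀ u ∈ f, UpClosed u) :
    UpClosed (graft f s) := by
  induction s generalizing f with
  | nil =>
    match f, h with
    | [t], _ => simpa [graft] using hf
  | node a l r hl hr =>
    simp only [numNodes] at h
    simp only [inorder, List.mem_append, List.mem_cons] at hs
    have ha := hs a (Or.inr (Or.inl rfl))
    exact ⟨fun _ => ha, fun _ => ha,
      hl _ (by simp; omega) (fun x hx => hs x (Or.inl hx))
        (fun u hu => hf u (List.mem_of_mem_take hu)),
      hr _ (by simp; omega) (fun x hx => hs x (Or.inr (Or.inr hx)))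
        (fun u hu => hf u (List.mem_of_mem_drop hu))⟩

lemma not_mem_inorder_uncircle (u : BinaryTree Bool) :
    true ∉ inorder (u.map fun _ => false) := by
  simp [inorder_map]

lemma true_mem_graft {s : BinaryTree Bool} (f : List (BinaryTree Bool))
    (h : f.length = s.numNodes + 1) (hf : ∀ u ∈ f, true ∉ inorder u)
    (hx : true ∈ inorder (graft f s)) : true ∈ inorder s := by
  rcases List.mem_append.1 ((inorder_graft_perm s f h).mem_iff.1 hx) with hx | hx
  · exact hx
  · obtain ⟨u, hu, hxu⟩ := List.mem_flatMap.1 hx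
    exact absurd hxu (hf u hu)

lemma upClosed_of_not_mem {u : BinaryTree Bool} (h : true ∉ inorder u) : UpClosed u := by
  induction u with
  | nil => trivial
  | node a l r hl hr =>
    simp only [inorder, List.mem_append, List.mem_cons, not_or] at h
    exact ⟨fun hx => absurd hx h.1, fun hx => absurd hx h.2.2, hl h.1, hr h.2.2⟩

lemma upClosed_graft_uncircled {s : BinaryTree Bool} (hs : UpClosed s)
    (f : List (BinaryTree Bool)) (h : f.length = s.numNodes + 1)
    (hf : ∀ u ∈ f, true ∉ inorder u) : UpClosed (graft f s) := by
  induction s generalizing f with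
  | nil =>
    match f, h with
    | [t], _ => exact upClosed_of_not_mem (by simpa [graft] using hf)
  | node a l r hl hr =>
    simp only [numNodes] at h
    obtain ⟨h1, h2, h3, h4⟩ := hs
    have ht : (f.take (l.numNodes + 1)).length = l.numNodes + 1 := by simp; omega
    have hd : (f.drop (l.numNodes + 1)).length = r.numNodes + 1 := by simp; omega
    have ft : ∀ u ∈ f.take (l.numNodes + 1), true ∉ inorder u :=
      fun u hu => hf u (List.mem_of_mem_take hu)
    have fd : ∀ u ∈ f.drop (l.numNodes + 1), true ∉ inorder u :=
      fun u hu => hf u (List.mem_of_mem_drop hu)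
    exact ⟨fun hx => h1 (true_mem_graft _ ht ft hx), fun hx => h2 (true_mem_graft _ hd fd hx),
      hl h3 _ ht ft, hr h4 _ hd fd⟩

lemma graft_ne_nil_of_ne_nil {s : BinaryTree α} (hs : s ≠ nil) (f : List (BinaryTree α)) :
    graft f s ≠ nil := by
  cases s with
  | nil => exact absurd rfl hs
  | node a l r => simp [graft]

lemma leftmostMinimal_graft_uncircled {s : BinaryTree Bool} (hs : LeftmostMinimal s)
    (f : List (BinaryTree Bool)) (h : f.length = s.numNodes + 1)
    (hf : ∀ u ∈ f, true ∉ inorder u) (h0 : f.headD nil = nil) :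
    LeftmostMinimal (graft f s) := by
  induction s generalizing f with
  | nil =>
    rw [graft, h0]
    trivial
  | node a l r hl hr =>
    simp only [numNodes] at h
    have e := headD_take f l.numNodes
    by_cases hn : l = nil
    · subst hn
      have hd : (f.drop ((nil : BinaryTree Bool).numNodes + 1)).length = r.numNodes + 1 := by
        simp at h ⊢; omega
      have g0 : graft (f.take ((nil : BinaryTree Bool).numNodes + 1)) nil = nil := by
        simp only [graft]; rw [e, h0]
      simp only [graft] at g0 ⊢
      rw [g0]
      exact ⟨hs.1, fun hx => hs.2
        (true_mem_graft _ hd (fun u hu => hf u (List.mem_of_mem_drop hu)) hx)⟩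
    · simp only [graft]
      rw [leftmostMinimal_node (graft_ne_nil_of_ne_nil hn _)]
      exact hl ((leftmostMinimal_node hn).1 hs) _ (by simp; omega)
        (fun u hu => hf u (List.mem_of_mem_take hu)) (by rw [e, h0])

end Aux

/-! ### The maps between ordered, bi-leveled and planar binary trees -/

/-- The label of the leftmost node, `σ₁` (and `0` for the tree without nodes). -/
def firstLabel (t : BinaryTree ℕ) : ℕ := (inorder t).headD 0

lemma isBiLeveled_circle (t : OrderedTree) :
    IsBiLeveled (t.1.map fun x => decide (firstLabel t.1 ≤ x)) := by
  have hup : ∀ (m : ℕ) (u : BinaryTree ℕ), Decreasing u →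
      UpClosed (u.map fun x => decide (m ≤ x)) := by
    intro m u hu
    induction u with
    | nil => trivial
    | node a l r hl hr =>
      obtain ⟨h1, h2, h3, h4⟩ := hu
      refine ⟨fun hx => ?_, fun hx => ?_, hl h3, hr h4⟩
      · rw [inorder_map, List.mem_map] at hx
        obtain ⟨y, hy, hm⟩ := hx
        have := h1 y hy
        simp at hm ⊢
        omega
      · rw [inorder_map, List.mem_map] at hx
        obtain ⟨y, hy, hm⟩ := hx
        have := h2 y hy
        simp at hm ⊢
        omega
  have hlm : ∀ (u : BinaryTree ℕ), Decreasing u →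
      LeftmostMinimal (u.map fun x => decide (firstLabel u ≤ x)) := by
    intro u hu
    induction u with
    | nil => trivial
    | node a l r hl hr =>
      obtain ⟨h1, h2, h3, h4⟩ := hu
      cases l with
      | nil =>
        refine ⟨by simp [firstLabel, inorder], fun hx => ?_⟩
        rw [inorder_map, List.mem_map] at hx
        obtain ⟨y, hy, hm⟩ := hx
        have := h2 y hy
        simp [firstLabel, inorder] at hm
        omega
      | node b l' r' =>
        have e : firstLabel (node a (node b l' r') r) = firstLabel (node b l' r') := by
          simp [firstLabel, inorder, List.headD_eq_head?_getD]
        have := hl h3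
        rw [e]
        exact this
  exact ⟨hup _ _ t.2.1, hlm _ t.2.1⟩

/-- `τ` forgets the labels of an ordered tree. -/
def tau (t : OrderedTree) : BinaryTree Unit := t.1.map fun _ => ()

/-- `β` forgets the labels of an ordered tree, save for circling all nodes whose label is at least
the label of the leftmost node. -/
def beta (t : OrderedTree) : BiTree :=
  ⟨t.1.map fun x => decide (firstLabel t.1 ≤ x), isBiLeveled_circle t⟩

/-- `φ` forgets which nodes of a bi-leveled tree are circled. -/
def phi (b : BiTree) : BinaryTree Unit := b.1.map fun _ => ()

/-! ### The vector spaces and the linear maps between them -/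

/-- The vector space with basis `F_σ`, `σ` an ordered tree. -/
abbrev SSym (k : Type*) [Field k] : Type _ := OrderedTree →₀ k

/-- The vector space with basis `F_t`, `t` a planar binary tree. -/
abbrev YSym (k : Type*) [Field k] : Type _ := BinaryTree Unit →₀ k

/-- The vector space with basis `F_b`, `b` a bi-leveled tree, where `b` may be the tree without
nodes: this is `MSym` with its degree-zero part put equal to `k`. -/
abbrev MSymOne (k : Type*) [Field k] : Type _ := BiTree →₀ k

/-- The space `MSym` with zero degree-zero part: the span of all `F_b`, `b` a
bi-leveled tree with at least one node. -/
def MSym (k : Type*) [Field k] : Submodule k (MSymOne k) :=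
  Finsupp.supported k k {b : BiTree | 0 < b.1.numNodes}

section Linear

variable (k : Type*) [Field k]

/-- The linear map `F_σ ↦ F_{τ(σ)}`. -/
def tauLin : SSym k →ₗ[k] YSym k := Finsupp.lmapDomain k k tau

/-- The linear map `F_σ ↦ F_{β(σ)}`. -/
def betaLin : SSym k →ₗ[k] MSymOne k := Finsupp.lmapDomain k k beta

/-- The linear map `F_b ↦ F_{φ(b)}`. -/
def phiLin : MSymOne k →ₗ[k] YSym k := Finsupp.lmapDomain k k phi

/-! ### The product of `SSym` -/

/-- The unit of `SSym`: the basis element of the ordered tree without nodes. -/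
def SSym.unit : SSym k := Finsupp.single ⟨nil, trivial, List.Perm.refl _⟩ 1

/-- `F_t · F_s`: the sum of the `F_{(t₀, …, t_p)/s}` over all `p`-splittings `(t₀, …, t_p)` of `t`,
where `p` is the number of nodes of `s`; the labels of `s` are incremented by the number of
nodes of `t`. -/
def SSym.mulBasis (t s : OrderedTree) : SSym k :=
  ((splittings s.1.numNodes t.1).attach.map fun f =>
    Finsupp.single (⟨graft f.1 (s.1.map (· + t.1.numNodes)), isOrdered_graft t s f.2⟩ : OrderedTree)
      (1 : k)).sum

/-- The product of `SSym`, extended bilinearly. -/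
def SSym.mul : SSym k →ₗ[k] SSym k →ₗ[k] SSym k :=
  Finsupp.linearCombination k fun t => Finsupp.linearCombination k fun s => SSym.mulBasis k t s

end Linear

/-! ### The action of `SSym` on `MSym` and the induced product -/

/-- The grafting `(b₀, …, b_p)/s` with its circling rules: if `b₀` has a node, then every node
originating in `s` is circled and the nodes of the `bᵢ` keep their circles; otherwise every
node originating in the `bᵢ` is uncircled and the nodes of `s` keep their circles. -/
def graftCircled (f : List (BinaryTree Bool)) (s : BinaryTree Bool) : BinaryTree Bool :=
  if 0 < (f.headD nil).numNodes then graft f (s.map fun _ => true)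
  else graft (f.map fun u => u.map fun _ => false) s

lemma isBiLeveled_graftCircled (b s : BiTree) {f : List (BinaryTree Bool)}
    (hf : f ∈ splittings s.1.numNodes b.1) : IsBiLeveled (graftCircled f s.1) := by
  have hlen := length_of_mem_splittings hf
  unfold graftCircled
  split_ifs with h
  · have h0 : f.headD nil ≠ nil := fun e => by rw [e] at h; simp at h
    exact ⟨upClosed_graft_of_forall f (by rw [numNodes_map, hlen]) (by simp [inorder_map])
      (upClosed_of_mem_splittings b.2.1 hf),
      leftmostMinimal_graft h0 (leftmostMinimal_of_mem_splittings b.2.2 hf)⟩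
  · have h0 : f.headD nil = nil := by
      apply eq_nil_of_inorder
      rw [← List.length_eq_zero_iff, length_inorder]
      omega
    have h1 : ∀ u ∈ f.map (fun u : BinaryTree Bool => u.map fun _ => false),
        true ∉ inorder u := by
      intro u hu
      obtain ⟨v, -, rfl⟩ := List.mem_map.1 hu
      exact not_mem_inorder_uncircle v
    have h2 : (f.map (fun u : BinaryTree Bool => u.map fun _ => false)).headD nil = nil := by
      cases f with
      | nil => rfl
      | cons u f => simp at h0; subst h0; rfl
    exact ⟨upClosed_graft_uncircled s.2.1 _ (by simp [hlen]) h1,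
      leftmostMinimal_graft_uncircled s.2.2 _ (by simp [hlen]) h1 h2⟩

section Action

variable (k : Type*) [Field k]

/-- `F_w · F_s` for an ordered tree `w` and a bi-leveled tree `s` with `p` nodes: the
sum of the `F_{(b₀, …, b_p)/s}` over all `p`-splittings `(b₀, …, b_p)` of `b = β(w)`. -/
def actBasis (w : OrderedTree) (s : BiTree) : MSymOne k :=
  ((splittings s.1.numNodes (beta w).1).attach.map fun f =>
    Finsupp.single (⟨graftCircled f.1 s.1, isBiLeveled_graftCircled (beta w) s f.2⟩ : BiTree)
      (1 : k)).sum

/-- The action of `SSym`, extended bilinearly. -/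
def act : SSym k →ₗ[k] MSymOne k →ₗ[k] MSymOne k :=
  Finsupp.linearCombination k fun w => Finsupp.linearCombination k fun s => actBasis k w s

/-- The unit of `MSym` with its degree-zero part put equal to `k`. -/
def MSymOne.unit : MSymOne k := Finsupp.single ⟨nil, trivial, trivial⟩ 1

/-- The product `F_a · F_b := F_{g(a)} · F_b` that the action induces by means of a map `g` from
bi-leveled trees to ordered trees (to be used for sections `g` of `β`), extended bilinearly. -/
def MSymOne.mul (g : BiTree → OrderedTree) : MSymOne k →ₗ[k] MSymOne k →ₗ[k] MSymOne k :=
  Finsupp.linearCombination k fun a => Finsupp.linearCombination k fun b => actBasis k (g a) b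

end Action

end MSymDefs

end

/-! The product and the action both come from one bilinear product on bi-leveled trees, and `β`
carries the product of ordered trees onto it. The crucial identity is termwise
(`map_beta_orderedTerms`): for each splitting of `t`, circling the grafted ordered tree gives the
circled grafting of the circled pieces. The two circling rules record whether the first letter of
the new permutation comes from `t` or from `s`, and every shifted label of `s` exceeds every label
of `t` (`beta_graft`).

Every bi-leveled tree is circled from an ordered tree (`beta_surjective`): number the uncircled
nodes in postorder, then the circled ones. So `MSymOne` is a quotient of `SSym`, and associativity
descends along the surjection `betaLin`. The action of `x` is multiplication by `betaLin k x`
(`act_eq`), and any section of `β` cancels against `β` in the induced product (`msymMul_eq`); hence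
all claims concern this one product.

Associativity upstairs is proved on words. A decreasing tree is determined by its in-order word
(`eq_of_inorder_eq`), and the words of the product's terms are the shuffles of the first word with
the shifted second one (`map_inorder_orderedTerms`). Thus associativity is that of shuffling
(`shuffles_assoc`). -/

namespace MSymDefs

/-! ### Bilinear extension of list-valued products -/

section Formal

variable (k : Type*) [Field k] {α β γ : Type*}

/-- The formal sum of the entries of a list. -/
noncomputable def formalSum (l : List α) : α →₀ k := (l.map fun a => Finsupp.single a (1 : k)).sum

/-- The bilinear extension of an operation on basis elements that returns a list of basis
elements, to be summed. -/
noncomputable def extendBilin (F : α → β → List γ) : (α →₀ k) →ₗ[k] (β →₀ k) →ₗ[k] (γ →₀ k) :=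
  Finsupp.linearCombination k fun a => Finsupp.linearCombination k fun b => formalSum k (F a b)

lemma formalSum_cons (a : α) (l : List α) :
    formalSum k (a :: l) = Finsupp.single a 1 + formalSum k l := by
  simp [formalSum]

lemma formalSum_append (l m : List α) :
    formalSum k (l ++ m) = formalSum k l + formalSum k m := by
  simp [formalSum]

lemma formalSum_perm {l m : List α} (h : l.Perm m) : formalSum k l = formalSum k m :=
  (h.map _).sum_eq

lemma lmapDomain_formalSum (g : α → β) (l : List α) :
    Finsupp.lmapDomain k k g (formalSum k l) = formalSum k (l.map g) := by
  induction l with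
  | nil => simp [formalSum]
  | cons a l ih => rw [formalSum_cons, map_add, ih, List.map_cons, formalSum_cons]; simp

lemma extendBilin_single (F : α → β → List γ) (a : α) (b : β) :
    extendBilin k F (Finsupp.single a 1) (Finsupp.single b 1) = formalSum k (F a b) := by
  simp [extendBilin]

lemma extendBilin_formalSum_left (F : α → β → List γ) (l : List α) (b : β) :
    extendBilin k F (formalSum k l) (Finsupp.single b 1) =
      formalSum k (l.flatMap fun a => F a b) := by
  induction l with
  | nil => simp [formalSum]
  | cons a l ih =>
    rw [formalSum_cons, map_add, LinearMap.add_apply, ih, extendBilin_single, List.flatMap_cons,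
      formalSum_append]

lemma extendBilin_formalSum_right (F : α → β → List γ) (a : α) (l : List β) :
    extendBilin k F (Finsupp.single a 1) (formalSum k l) =
      formalSum k (l.flatMap fun b => F a b) := by
  induction l with
  | nil => simp [formalSum]
  | cons b l ih =>
    rw [formalSum_cons, map_add, ih, extendBilin_single, List.flatMap_cons, formalSum_append]

/-- A permutation of the lists of terms is enough, because formal sums forget the order, and
trilinear maps are determined on basis triples. -/
lemma extendBilin_assoc {F : α → α → List α}
    (h : ∀ a b c, ((F a b).flatMap fun u => F u c).Perm ((F b c).flatMap fun u => F a u))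
    (x y z : α →₀ k) :
    extendBilin k F (extendBilin k F x y) z = extendBilin k F x (extendBilin k F y z) := by
  -- Both bracketings are packaged as trilinear maps so that extensionality reduces to basis
  -- elements.
  have key : (extendBilin k F).compr₂ (extendBilin k F) =
      ((LinearMap.llcomp k (α →₀ k) (α →₀ k) (α →₀ k)).flip.comp (extendBilin k F)).flip.comp
        (extendBilin k F) := by
    ext a b c : 6
    simp only [LinearMap.comp_apply, Finsupp.lsingle_apply, LinearMap.compr₂_apply,
      LinearMap.flip_apply, LinearMap.llcomp_apply, extendBilin_single,
      extendBilin_formalSum_left, extendBilin_formalSum_right]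
    exact formalSum_perm k (h a b c)
  exact congrArg (fun f => f x y z) key

lemma lmapDomain_extendBilin {F : α → α → List α} {G : β → β → List β} {g : α → β}
    (h : ∀ a b, (F a b).map g = G (g a) (g b)) (x y : α →₀ k) :
    Finsupp.lmapDomain k k g (extendBilin k F x y) =
      extendBilin k G (Finsupp.lmapDomain k k g x) (Finsupp.lmapDomain k k g y) := by
  have key : (extendBilin k F).compr₂ (Finsupp.lmapDomain k k g) =
      (extendBilin k G).compl₁₂ (Finsupp.lmapDomain k k g) (Finsupp.lmapDomain k k g) := by
    ext a b : 4
    simp only [LinearMap.comp_apply, Finsupp.lsingle_apply, LinearMap.compr₂_apply,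
      LinearMap.compl₁₂_apply, extendBilin_single, Finsupp.lmapDomain_apply,
      Finsupp.mapDomain_single]
    rw [← Finsupp.lmapDomain_apply k k, lmapDomain_formalSum, h]
  exact congrArg (fun f => f x y) key

end Formal

/-! ### Shuffles of words -/

section Shuffle

variable {α β : Type*}

/-- The list of all shuffles of two words. -/
def shuffles : List α → List α → List (List α)
  | u, [] => [u]
  | [], v => [v]
  | a :: u, b :: v =>
    (shuffles (a :: u) v).map (b :: ·) ++ (shuffles u (b :: v)).map (a :: ·)
termination_by u v => u.length + v.length

lemma shuffles_nil_right (u : List α) : shuffles u [] = [u] := by rw [shuffles]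

lemma shuffles_nil_left (v : List α) : shuffles [] v = [v] := by
  cases v <;> simp [shuffles]

lemma shuffles_cons_cons (a b : α) (u v : List α) :
    shuffles (a :: u) (b :: v) =
      (shuffles (a :: u) v).map (b :: ·) ++ (shuffles u (b :: v)).map (a :: ·) := by
  rw [shuffles]

lemma shuffles_map (g : α → β) (u v : List α) :
    shuffles (u.map g) (v.map g) = (shuffles u v).map (List.map g) := by
  induction u, v using shuffles.induct with
  | case1 u => simp [shuffles_nil_right]
  | case2 v _ => simp [shuffles_nil_left]
  | case3 a u b v ih1 ih2 =>
    simp only [List.map_cons] at ih1 ih2 ⊢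
    simp [shuffles_cons_cons, ih1, ih2, Function.comp_def]

/-- Shuffles are sorted by the number `i` of letters of `u` placed before `b`. This is the recursion
of `splittings`, where `i` numbers the leftmost chosen leaf. -/
lemma shuffles_cons_right (u : List α) (b : α) (v : List α) :
    shuffles u (b :: v) = (List.range (u.length + 1)).flatMap fun i =>
      (shuffles (u.drop i) v).map fun w => u.take i ++ b :: w := by
  induction u with
  | nil => simp [shuffles_nil_left]
  | cons a u ih =>
    rw [shuffles_cons_cons, ih, List.length_cons, List.range_succ_eq_map (n := u.length + 1)]
    simp [List.flatMap_map, List.map_flatMap, Function.comp_def]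

lemma perm_append_middle (A B C D : List α) :
    ((A ++ B) ++ (C ++ D)).Perm ((A ++ C) ++ (B ++ D)) := by
  rw [← Multiset.coe_eq_coe]
  simp only [← Multiset.coe_add]
  abel

lemma flatMap_append_perm (l : List β) (f g : β → List α) :
    (l.flatMap fun x => f x ++ g x).Perm (l.flatMap f ++ l.flatMap g) := by
  induction l with
  | nil => simp
  | cons x l ih =>
    simp only [List.flatMap_cons]
    exact ((ih.append_left _).trans (perm_append_middle _ _ _ _))

/-- Shuffling words is associative. -/
theorem shuffles_assoc (u v w : List α) :
    ((shuffles u v).flatMap fun x => shuffles x w).Perm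
      ((shuffles v w).flatMap fun x => shuffles u x) := by
  match u, v, w with
  | u, v, [] => simp [shuffles_nil_right]
  | u, [], w => simp [shuffles_nil_right, shuffles_nil_left]
  | [], v, w => simp [shuffles_nil_left]
  | a :: u, b :: v, c :: w =>
    -- The triple shuffles are sorted by their first letter: one recursive call each for `c`, `b`
    -- and `a`.
    have h1 := (shuffles_assoc (a :: u) (b :: v) w).map (c :: ·)
    have h2 := (shuffles_assoc (a :: u) v (c :: w)).map (b :: ·)
    have h3 := (shuffles_assoc u (b :: v) (c :: w)).map (a :: ·)
    have e1 := flatMap_append_perm (shuffles (a :: u) v)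
      (fun x => (shuffles (b :: x) w).map (c :: ·)) (fun x => (shuffles x (c :: w)).map (b :: ·))
    have e2 := flatMap_append_perm (shuffles u (b :: v))
      (fun x => (shuffles (a :: x) w).map (c :: ·)) (fun x => (shuffles x (c :: w)).map (a :: ·))
    have e3 := flatMap_append_perm (shuffles (b :: v) w)
      (fun x => (shuffles (a :: u) x).map (c :: ·)) (fun x => (shuffles u (c :: x)).map (a :: ·))
    have e4 := flatMap_append_perm (shuffles v (c :: w))
      (fun x => (shuffles (a :: u) x).map (b :: ·)) (fun x => (shuffles u (b :: x)).map (a :: ·))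
    simp only [shuffles_cons_cons, List.flatMap_append, List.flatMap_map, List.map_flatMap,
      List.map_append] at h1 h2 h3 ⊢
    rw [← Multiset.coe_eq_coe] at *
    simp only [← Multiset.coe_add] at *
    rw [e1, e2, e3, e4]
    -- The shuffles starting with `c` arise in two blocks on the left side; the exchange puts them
    -- together so that `h1` applies.
    rw [add_add_add_comm, h1, h2, h3]
    abel
termination_by u.length + v.length + w.length

end Shuffle

/-! ### Splittings, graftings and maps -/

section Trees

variable {α β : Type*}

lemma map_congr_inorder {g h : α → β} {t : BinaryTree α} (H : ∀ x ∈ inorder t, g x = h x) :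
    t.map g = t.map h := by
  induction t with
  | nil => rfl
  | node a l r hl hr =>
    simp only [inorder, List.mem_append, List.mem_cons] at H
    simp only [BinaryTree.map]
    rw [hl fun x hx => H x (Or.inl hx), hr fun x hx => H x (Or.inr (Or.inr hx)),
      H a (Or.inr (Or.inl rfl))]

lemma map_comp_map {γ : Type*} (g : α → β) (h : β → γ) (t : BinaryTree α) :
    (t.map g).map h = t.map (h ∘ g) := by
  induction t with
  | nil => rfl
  | node a l r hl hr => simp [BinaryTree.map, hl, hr]

lemma cut_map (g : α → β) (t : BinaryTree α) (i : ℕ) :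
    cut (t.map g) i = ((cut t i).1.map g, (cut t i).2.map g) := by
  induction t generalizing i with
  | nil => rfl
  | node a l r hl hr =>
    by_cases h : i ≤ l.numNodes <;> simp [BinaryTree.map, cut, numNodes_map, h, hl, hr]

lemma splittings_map (g : α → β) (p : ℕ) (t : BinaryTree α) :
    splittings p (t.map g) = (splittings p t).map (List.map (BinaryTree.map g)) := by
  induction p generalizing t with
  | zero => simp [splittings]
  | succ p ih =>
    simp [splittings, numNodes_map, cut_map, ih, List.map_flatMap, Function.comp_def]

lemma graft_map (g : α → β) (s : BinaryTree α) (f : List (BinaryTree α)) :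
    (graft f s).map g = graft (f.map (BinaryTree.map g)) (s.map g) := by
  induction s generalizing f with
  | nil => cases f <;> rfl
  | node a l r hl hr => simp [BinaryTree.map, graft, numNodes_map, hl, hr]

/-! ### In-order words of cuts and graftings -/

lemma inorder_cut_eq (t : BinaryTree α) {i : ℕ} (hi : i ≤ t.numNodes) :
    inorder (cut t i).1 = (inorder t).take i ∧ inorder (cut t i).2 = (inorder t).drop i := by
  induction t generalizing i with
  | nil => simp [cut, inorder]
  | node a l r hl hr =>
    simp only [numNodes] at hi
    by_cases h : i ≤ l.numNodes
    · have := hl h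
      simp [cut, h, inorder, this, List.take_append, List.drop_append, length_inorder,
        Nat.sub_eq_zero_of_le h]
    -- The leaf lies in the right subtree, where its number is `j`: the left subtree has one leaf
    -- more than it has nodes.
    · obtain ⟨j, rfl⟩ : ∃ j, i = l.numNodes + (j + 1) := ⟨i - l.numNodes - 1, by omega⟩
      have := hr (i := j) (by omega)
      have e : l.numNodes + (j + 1) - l.numNodes - 1 = j := by omega
      simp only [cut, h, if_false, e, inorder, this.1, this.2]
      rw [← length_inorder, List.take_length_add_append, List.drop_length_add_append]
      simp

/-- The word of a grafting: the letters of a word are put between the words of a forest. -/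
def interleave : List (List α) → List α → List α
  | ws, [] => ws.headD []
  | ws, x :: xs => ws.headD [] ++ x :: interleave ws.tail xs

/-- This mirrors `graft` at a root `a`. No condition on the length of `ws` is needed, since missing
words count as empty on both sides. -/
lemma interleave_append (ws : List (List α)) (u v : List α) (a : α) :
    interleave ws (u ++ a :: v) =
      interleave (ws.take (u.length + 1)) u ++ a :: interleave (ws.drop (u.length + 1)) v := by
  induction u generalizing ws with
  | nil => cases ws <;> simp [interleave]
  | cons b u ih => cases ws <;> simp [interleave, ih]

lemma inorder_graft (s : BinaryTree α) (f : List (BinaryTree α)) :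
    inorder (graft f s) = interleave (f.map inorder) (inorder s) := by
  induction s generalizing f with
  | nil => cases f <;> rfl
  | node a l r hl hr =>
    simp [graft, inorder, hl, hr, interleave_append, length_inorder]

/-- Cutting at leaf `i` cuts the word after `i` letters, so choosing the leftmost leaf amounts to
choosing how many letters precede the first letter of `v`; the remaining piece is handled by
induction. -/
lemma map_interleave_splittings (v : List α) (t : BinaryTree α) :
    ((splittings v.length t).map fun f => interleave (f.map inorder) v) =
      shuffles (inorder t) v := by
  induction v generalizing t with
  | nil => simp [splittings, interleave, shuffles_nil_right]
  | cons b v ih =>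
    rw [shuffles_cons_right, length_inorder, List.length_cons, splittings, List.map_flatMap]
    refine List.flatMap_congr fun i hi => ?_
    have hi' : i ≤ t.numNodes := by simpa [Nat.lt_succ_iff] using hi
    rw [← (inorder_cut_eq t hi').1, ← (inorder_cut_eq t hi').2, ← ih]
    simp [interleave, Function.comp_def]

/-- The words of the graftings of the splittings of `t` onto `s` are the shuffles of the words. -/
lemma map_inorder_graft_splittings (t s : BinaryTree α) :
    ((splittings s.numNodes t).map fun f => inorder (graft f s)) =
      shuffles (inorder t) (inorder s) := by
  simp only [← map_interleave_splittings, inorder_graft, length_inorder]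

lemma splittings_nil (p : ℕ) :
    splittings p (nil : BinaryTree α) = [List.replicate (p + 1) nil] := by
  induction p with
  | zero => rfl
  | succ p ih => simp [splittings, cut, ih, List.replicate_succ]

lemma graft_replicate_nil (s : BinaryTree α) :
    graft (List.replicate (s.numNodes + 1) nil) s = s := by
  induction s with
  | nil => rfl
  | node a l r hl hr =>
    simp only [graft, numNodes, List.take_replicate, List.drop_replicate]
    rw [show min (l.numNodes + 1) (l.numNodes + r.numNodes + 1 + 1) = l.numNodes + 1 by omega,
      show l.numNodes + r.numNodes + 1 + 1 - (l.numNodes + 1) = r.numNodes + 1 by omega, hl, hr]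

end Trees

/-! ### Decreasing trees and their words -/

/-- Each marked letter is the strict maximum of the same word, so the two occupy the same place.
This recovers the root of a decreasing tree from its word. -/
lemma append_cons_inj_of_lt {l l' r r' : List ℕ} {a a' : ℕ}
    (h : l ++ a :: r = l' ++ a' :: r') (hl : ∀ x ∈ l, x < a) (hr : ∀ x ∈ r, x < a)
    (hl' : ∀ x ∈ l', x < a') (hr' : ∀ x ∈ r', x < a') : l = l' ∧ a = a' ∧ r = r' := by
  induction l generalizing l' with
  | nil =>
    cases l' with
    | nil => simpa using h
    | cons b l' =>
      simp only [List.nil_append, List.cons_append, List.cons.injEq] at h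
      obtain ⟨rfl, rfl⟩ := h
      have h1 := hl' a (by simp)
      have h2 := hr a' (by simp)
      omega
  | cons b l ih =>
    cases l' with
    | nil =>
      simp only [List.nil_append, List.cons_append, List.cons.injEq] at h
      obtain ⟨rfl, rfl⟩ := h
      have h1 := hl b (by simp)
      have h2 := hr' a (by simp)
      omega
    | cons b' l' =>
      simp only [List.cons_append, List.cons.injEq] at h
      obtain ⟨h1, h2, h3⟩ := ih h.2 (fun x hx => hl x (List.mem_cons_of_mem _ hx))
        (fun x hx => hl' x (List.mem_cons_of_mem _ hx))
      exact ⟨by rw [h.1, h1], h2, h3⟩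

/-- A decreasing tree is determined by its word. -/
lemma eq_of_inorder_eq {t s : BinaryTree ℕ} (ht : Decreasing t) (hs : Decreasing s)
    (h : inorder t = inorder s) : t = s := by
  induction t generalizing s with
  | nil => exact (eq_nil_of_inorder h.symm).symm
  | node a l r ihl ihr =>
    cases s with
    | nil => simp [inorder] at h
    | node b l' r' =>
      obtain ⟨h1, h2, h3, h4⟩ := ht
      obtain ⟨h1', h2', h3', h4'⟩ := hs
      obtain ⟨e1, e2, e3⟩ := append_cons_inj_of_lt h h1 h2 h1' h2'
      rw [ihl h3 h3' e1, ihr h4 h4' e3, e2]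

lemma inorder_val_injective : Function.Injective fun t : OrderedTree => inorder t.1 :=
  fun t s h => Subtype.ext (eq_of_inorder_eq t.2.1 s.2.1 h)

/-! ### The products on basis elements -/

/-- The terms of the product of two ordered trees. -/
def orderedTerms (t s : OrderedTree) : List OrderedTree :=
  (splittings s.1.numNodes t.1).attach.map fun f =>
    ⟨graft f.1 (s.1.map (· + t.1.numNodes)), isOrdered_graft t s f.2⟩

/-- The terms of the product of two bi-leveled trees. -/
def biLeveledTerms (b s : BiTree) : List BiTree :=
  (splittings s.1.numNodes b.1).attach.map fun f =>
    ⟨graftCircled f.1 s.1, isBiLeveled_graftCircled b s f.2⟩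

lemma map_val_orderedTerms (t s : OrderedTree) :
    (orderedTerms t s).map Subtype.val =
      (splittings s.1.numNodes t.1).map fun f => graft f (s.1.map (· + t.1.numNodes)) := by
  simp [orderedTerms, Function.comp_def]

lemma map_val_biLeveledTerms (b s : BiTree) :
    (biLeveledTerms b s).map Subtype.val =
      (splittings s.1.numNodes b.1).map fun f => graftCircled f s.1 := by
  simp [biLeveledTerms, Function.comp_def]

/-- This identifies the product with the shifted shuffle product of permutations. -/
lemma map_inorder_orderedTerms (t s : OrderedTree) :
    (orderedTerms t s).map (fun u => inorder u.1) =
      shuffles (inorder t.1) ((inorder s.1).map (· + t.1.numNodes)) := by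
  rw [← inorder_map, ← map_inorder_graft_splittings, numNodes_map,
    show (fun u : OrderedTree => inorder u.1) = inorder ∘ Subtype.val from rfl,
    ← List.map_map, map_val_orderedTerms]
  simp [Function.comp_def]

lemma numNodes_of_mem_orderedTerms {t s u : OrderedTree} (h : u ∈ orderedTerms t s) :
    u.1.numNodes = t.1.numNodes + s.1.numNodes := by
  simp only [orderedTerms, List.mem_map, List.mem_attach, true_and] at h
  obtain ⟨⟨f, hf⟩, rfl⟩ := h
  rw [numNodes_graft _ _ (by rw [numNodes_map, length_of_mem_splittings hf]),
    inorder_of_mem_splittings hf, length_inorder, numNodes_map, add_comm]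

/-- Words separate ordered trees, so the terms may be compared through their words. Both sides then
list the shuffles of three words, the second shifted by the size of `t` and the third by the sizes
of `t` and `s`. -/
lemma orderedTerms_assoc (t s r : OrderedTree) :
    ((orderedTerms t s).flatMap fun u => orderedTerms u r).Perm
      ((orderedTerms s r).flatMap fun u => orderedTerms t u) := by
  rw [← List.map_perm_map_iff inorder_val_injective, List.map_flatMap, List.map_flatMap]
  have e1 : ((orderedTerms t s).flatMap fun u => (orderedTerms u r).map fun u => inorder u.1) =
      ((orderedTerms t s).map fun u => inorder u.1).flatMap fun w =>
        shuffles w ((inorder r.1).map (· + (t.1.numNodes + s.1.numNodes))) := by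
    rw [List.flatMap_map]
    refine List.flatMap_congr fun u hu => ?_
    rw [map_inorder_orderedTerms, numNodes_of_mem_orderedTerms hu]
  have e2 : ((orderedTerms s r).flatMap fun u => (orderedTerms t u).map fun u => inorder u.1) =
      (((orderedTerms s r).map fun u => inorder u.1).map (List.map (· + t.1.numNodes))).flatMap
        fun w => shuffles (inorder t.1) w := by
    rw [List.map_map, List.flatMap_map]
    refine List.flatMap_congr fun u hu => ?_
    rw [map_inorder_orderedTerms]
    rfl
  rw [e1, e2, map_inorder_orderedTerms, map_inorder_orderedTerms, ← shuffles_map, List.map_map]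
  -- What remains is to match the two shifts of the third word: one by the sum of the sizes, the
  -- other in two stages.
  convert shuffles_assoc _ _ _ using 5
  simp only [Function.comp_apply]
  omega

/-! ### Compatibility of circling with grafting -/

lemma firstLabel_mem {t : BinaryTree ℕ} (h : t ≠ nil) : firstLabel t ∈ inorder t := by
  unfold firstLabel
  cases e : inorder t with
  | nil => exact absurd (eq_nil_of_inorder e) h
  | cons a l => simp

lemma firstLabel_eq_of_headD_ne_nil {f : List (BinaryTree ℕ)} {w : List ℕ} (s : BinaryTree ℕ)
    (hf : f.flatMap inorder = w) (h0 : f.headD nil ≠ nil) :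
    firstLabel (graft f s) = w.headD 0 := by
  subst hf
  cases f with
  | nil => simp at h0
  | cons u f =>
    simp only [List.headD_cons] at h0
    unfold firstLabel
    rw [inorder_graft]
    cases e : inorder u with
    | nil => exact absurd (eq_nil_of_inorder e) h0
    | cons a l => cases inorder s <;> simp [interleave, e]

lemma firstLabel_eq_of_headD_eq_nil {f : List (BinaryTree ℕ)} (s : BinaryTree ℕ)
    (h0 : f.headD nil = nil) : firstLabel (graft f s) = firstLabel s := by
  unfold firstLabel
  rw [inorder_graft]
  have : (f.map inorder).headD [] = [] := by
    cases f with
    | nil => rfl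
    | cons u f => simp at h0; simp [h0, inorder]
  cases inorder s <;> simp only [interleave, this, List.nil_append, List.headD_cons]

/-- If the first piece has a node, the first letter is still that of `t`: nodes of `t` keep their
circles and all nodes of `s`, having larger labels, are circled. If it is empty and `s` is not, the
first letter is the shifted first letter of `s`, which exceeds all labels of `t`: those nodes lose
their circles, while comparisons within `s` are unaffected by the shift. -/
lemma beta_graft (t s : OrderedTree) {f : List (BinaryTree ℕ)}
    (hf : f ∈ splittings s.1.numNodes t.1) :
    (graft f (s.1.map (· + t.1.numNodes))).map
        (fun x => decide (firstLabel (graft f (s.1.map (· + t.1.numNodes))) ≤ x)) =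
      graftCircled (f.map (BinaryTree.map fun x => decide (firstLabel t.1 ≤ x))) (beta s).1 := by
  have hin := inorder_of_mem_splittings hf
  have hlen := length_of_mem_splittings hf
  have ht : ∀ x ∈ inorder t.1, 1 ≤ x ∧ x ≤ t.1.numNodes := fun x hx => by
    have := t.2.2.mem_iff.1 hx
    simp only [List.mem_range'_1] at this
    omega
  have hs : ∀ x ∈ inorder s.1, 1 ≤ x := fun x hx => by
    have := s.2.2.mem_iff.1 hx
    simp only [List.mem_range'_1] at this
    omega
  have hhead : (f.map (BinaryTree.map fun x => decide (firstLabel t.1 ≤ x))).headD nil =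
      (f.headD nil).map fun x => decide (firstLabel t.1 ≤ x) := by
    cases f <;> rfl
  have hpos : 0 < (f.headD nil).numNodes ↔ f.headD nil ≠ nil := by
    cases f.headD nil <;> simp
  unfold graftCircled
  rw [hhead, numNodes_map, graft_map, map_comp_map]
  by_cases h0 : f.headD nil = nil
  · rw [if_neg (by rw [hpos]; exact not_not.2 h0), firstLabel_eq_of_headD_eq_nil _ h0]
    -- With `s` a single leaf the forest is its first piece alone, so both graftings are empty and
    -- there is no first letter to compare.
    by_cases hn : s.1 = nil
    · simp only [hn, numNodes, beta, BinaryTree.map] at hlen ⊢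
      match f, hlen with
      | [u], _ =>
        simp only [List.headD_cons] at h0
        simp [h0, BinaryTree.map]
    · obtain ⟨a, l, e⟩ : ∃ a l, inorder s.1 = a :: l := by
        cases e : inorder s.1 with
        | nil => exact absurd (eq_nil_of_inorder e) hn
        | cons a l => exact ⟨a, l, rfl⟩
      have e1 : firstLabel s.1 = a := by simp [firstLabel, e]
      have e2 : firstLabel (s.1.map (· + t.1.numNodes)) = a + t.1.numNodes := by
        simp [firstLabel, inorder_map, e]
      -- Labels start at `1`, which makes the shifted first label strictly larger than every label
      -- of `t`.
      have ha := hs a (by simp [e])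
      rw [e2, List.map_map]
      congr 1
      · refine List.map_congr_left fun u hu => ?_
        rw [Function.comp_apply, map_comp_map]
        refine map_congr_inorder fun x hx => ?_
        have := (ht x (hin ▸ List.mem_flatMap.2 ⟨u, hu, hx⟩)).2
        simp only [Function.comp_apply, decide_eq_false_iff_not]
        omega
      · unfold beta
        refine map_congr_inorder fun x hx => ?_
        simp [e1]
  · rw [if_pos (hpos.2 h0), firstLabel_eq_of_headD_ne_nil _ hin h0]
    -- Splitting the empty tree gives only empty pieces, contrary to `h0`.
    have hn : t.1 ≠ nil := by
      rintro e
      rw [e, splittings_nil] at hf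
      simp at hf
      subst hf
      simp [List.replicate_succ] at h0
    have h1 := (ht _ (firstLabel_mem hn)).2
    unfold beta
    rw [map_comp_map]
    congr 1
    refine map_congr_inorder fun x hx => ?_
    have : firstLabel t.1 ≤ x + t.1.numNodes := by omega
    simpa [firstLabel] using this

/-- Splittings depend only on the shape of a tree, so both lists are indexed by the same splittings
in the same order, and `beta_graft` compares them entry by entry. -/
lemma map_beta_orderedTerms (t s : OrderedTree) :
    (orderedTerms t s).map beta = biLeveledTerms (beta t) (beta s) := by
  refine (List.map_injective_iff.2 Subtype.val_injective) ?_
  have e : splittings (beta s).1.numNodes (beta t).1 = (splittings s.1.numNodes t.1).map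
      (List.map (BinaryTree.map fun x => decide (firstLabel t.1 ≤ x))) := by
    simp only [beta, numNodes_map, splittings_map]
  rw [map_val_biLeveledTerms, e, ← List.attach_map_subtype_val (splittings s.1.numNodes t.1)]
  simp only [orderedTerms, List.map_map]
  exact List.map_congr_left fun f _ => beta_graft t s f.2

/-! ### `β` is surjective -/

/-- The labelling of the nodes that labels in postorder the uncircled nodes by `u`, `u + 1`, … and
the circled ones by `v`, `v + 1`, …. -/
def labelling : BinaryTree Bool → ℕ → ℕ → BinaryTree ℕ
  | nil, _, _ => nil
  | node c l r, u, v =>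
    node (if c then v + (inorder l).count true + (inorder r).count true
        else u + (inorder l).count false + (inorder r).count false)
      (labelling l u v)
      (labelling r (u + (inorder l).count false) (v + (inorder l).count true))

lemma numNodes_labelling (t : BinaryTree Bool) (u v : ℕ) :
    (labelling t u v).numNodes = t.numNodes := by
  induction t generalizing u v with
  | nil => rfl
  | node c l r hl hr => simp [labelling, hl, hr]

lemma inorder_labelling_perm (t : BinaryTree Bool) (u v : ℕ) :
    (inorder (labelling t u v)).Perm
      (List.range' u ((inorder t).count false) ++ List.range' v ((inorder t).count true)) := by
  induction t generalizing u v with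
  | nil => simp [labelling, inorder]
  | node c l r hl hr =>
    have h1 := hl u v
    have h2 := hr (u + (inorder l).count false) (v + (inorder l).count true)
    rw [← Multiset.coe_eq_coe] at h1 h2 ⊢
    simp only [labelling, inorder, List.count_append, List.count_cons]
    cases c
    all_goals
      simp only [← Multiset.coe_add, ← Multiset.cons_coe, ← Multiset.singleton_add] at h1 h2 ⊢
      rw [h1, h2]
      simp [← List.range'_append_1, ← Multiset.coe_add, ← Multiset.cons_coe,
        ← Multiset.singleton_add, ← add_assoc]
      abel

lemma mem_labelling {t : BinaryTree Bool} {u v x : ℕ} (hx : x ∈ inorder (labelling t u v)) :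
    (u ≤ x ∧ x < u + (inorder t).count false) ∨ (v ≤ x ∧ x < v + (inorder t).count true) := by
  have := (inorder_labelling_perm t u v).mem_iff.1 hx
  simpa only [List.mem_append, List.mem_range'_1] using this

/-- In postorder a node follows its descendants, so its label is the largest of its kind in its
subtree. A circled node also beats uncircled descendants by `h`, and an uncircled node has no
circled ones. -/
lemma decreasing_labelling {t : BinaryTree Bool} (ht : UpClosed t) {u v : ℕ}
    (h : u + (inorder t).count false ≤ v) : Decreasing (labelling t u v) := by
  induction t generalizing u v with
  | nil => trivial
  | node c l r hl hr =>
    obtain ⟨h1, h2, h3, h4⟩ := ht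
    simp only [inorder, List.count_append, List.count_cons] at h
    refine ⟨fun x hx => ?_, fun x hx => ?_, hl h3 (by omega), hr h4 (by omega)⟩
    · have := mem_labelling hx
      cases c
      -- The block of circled labels below an uncircled node is empty, which rules out the second
      -- alternative.
      · rw [List.count_eq_zero.2 (fun hm => Bool.false_ne_true (h1 hm))] at this
        simp
        omega
      · simp
        omega
    · have := mem_labelling hx
      cases c
      · rw [List.count_eq_zero.2 (fun hm => Bool.false_ne_true (h2 hm))] at this
        simp
        omega
      · simp
        omega

/-- A threshold between the two blocks of labels recovers the circles. A free `m` is needed because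
`u` and `v` change in the induction while the threshold stays. -/
lemma map_labelling (t : BinaryTree Bool) {u v m : ℕ} (hv : m ≤ v)
    (hu : u + (inorder t).count false ≤ m) :
    (labelling t u v).map (fun x => decide (m ≤ x)) = t := by
  induction t generalizing u v with
  | nil => rfl
  | node c l r hl hr =>
    simp only [inorder, List.count_append, List.count_cons] at hu
    simp only [labelling, BinaryTree.map]
    rw [hl hv (by omega), hr (by omega) (by omega)]
    cases c
    · simp at hu ⊢
      omega
    · simp
      omega

/-- The leftmost node is the first circled node in postorder, as it is circled and has no circled
descendants. -/
lemma firstLabel_labelling {t : BinaryTree Bool} (ht : LeftmostMinimal t) (hn : t ≠ nil)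
    (u v : ℕ) : firstLabel (labelling t u v) = v := by
  induction t generalizing u v with
  | nil => exact absurd rfl hn
  | node c l r hl hr =>
    by_cases h : l = nil
    · subst h
      obtain ⟨rfl, h⟩ := ht
      simp [firstLabel, labelling, inorder, List.count_eq_zero.2 h]
    · refine Eq.trans ?_ (hl ((leftmostMinimal_node h).1 ht) h u v)
      have hne : inorder (labelling l u v) ≠ [] := fun e => h <| by
        apply eq_nil_of_inorder
        rw [← List.length_eq_zero_iff, length_inorder, ← numNodes_labelling l u v,
          ← length_inorder, e]
        rfl
      simp only [firstLabel, labelling, inorder]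
      cases e : inorder (labelling l u v) with
      | nil => exact absurd e hne
      | cons a w => rfl

lemma beta_surjective : Function.Surjective beta := by
  rintro ⟨b, hu, hm⟩
  have hc : (inorder b).count false + (inorder b).count true = b.numNodes := by
    rw [← length_inorder, List.count_false_add_count_true]
  -- The circled labels begin right after the last uncircled one, so that together the labels fill
  -- `1, …, n`.
  refine ⟨⟨labelling b 1 (1 + (inorder b).count false), decreasing_labelling hu le_rfl, ?_⟩, ?_⟩
  · refine (inorder_labelling_perm b _ _).trans ?_
    rw [List.range'_append_1, numNodes_labelling, hc]
  · apply Subtype.ext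
    by_cases hn : b = nil
    · subst hn
      rfl
    · simp only [beta, firstLabel_labelling hm hn]
      exact map_labelling b le_rfl le_rfl

/-! ### The product of `MSymOne` -/

lemma biLeveledTerms_nil_left (s : BiTree) :
    biLeveledTerms ⟨nil, trivial, trivial⟩ s = [s] := by
  refine (List.map_injective_iff.2 Subtype.val_injective) ?_
  rw [map_val_biLeveledTerms]
  simp [splittings_nil, graftCircled, List.replicate_succ, BinaryTree.map]
  rw [← List.replicate_succ, graft_replicate_nil]

lemma biLeveledTerms_nil_right (b : BiTree) :
    biLeveledTerms b ⟨nil, trivial, trivial⟩ = [b] := by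
  refine (List.map_injective_iff.2 Subtype.val_injective) ?_
  rw [map_val_biLeveledTerms]
  -- The only splitting has `b` itself as first piece: if `b` has a node it keeps its circles, and
  -- otherwise there is nothing to uncircle.
  rcases b with ⟨_ | _, _⟩ <;> simp [splittings, graftCircled, graft, BinaryTree.map]

lemma numNodes_pos_of_mem_biLeveledTerms {b s u : BiTree} (hs : 0 < s.1.numNodes)
    (h : u ∈ biLeveledTerms b s) : 0 < u.1.numNodes := by
  simp only [biLeveledTerms, List.mem_map, List.mem_attach, true_and] at h
  obtain ⟨⟨f, hf⟩, rfl⟩ := h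
  have hlen := length_of_mem_splittings hf
  simp only [graftCircled]
  split_ifs
  · rw [numNodes_graft _ _ (by rw [numNodes_map, hlen]), numNodes_map]
    omega
  · rw [numNodes_graft _ _ (by rw [List.length_map, hlen])]
    omega

section Products

variable (k : Type*) [Field k]

lemma ssymMul_eq : SSym.mul k = extendBilin k orderedTerms := by
  simp [SSym.mul, extendBilin, SSym.mulBasis, formalSum, orderedTerms, Function.comp_def]

lemma actBasis_eq (w : OrderedTree) (s : BiTree) :
    actBasis k w s = formalSum k (biLeveledTerms (beta w) s) := by
  simp [actBasis, formalSum, biLeveledTerms, Function.comp_def]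

/-- The action sees an ordered tree only through `β`, so every claim about it is a claim about the
product of bi-leveled trees. -/
lemma act_eq (x : SSym k) (m : MSymOne k) :
    act k x m = extendBilin k biLeveledTerms (betaLin k x) m := by
  simp only [act, actBasis_eq, extendBilin, betaLin, Finsupp.lmapDomain_apply,
    Finsupp.linearCombination_mapDomain]
  rfl

lemma msymMul_eq {g : BiTree → OrderedTree} (hg : Function.RightInverse g beta) :
    MSymOne.mul k g = extendBilin k biLeveledTerms := by
  simp only [MSymOne.mul, actBasis_eq, hg _, extendBilin]

lemma betaLin_unit : betaLin k (SSym.unit k) = MSymOne.unit k := by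
  simp only [betaLin, SSym.unit, MSymOne.unit, Finsupp.lmapDomain_apply, Finsupp.mapDomain_single]
  rfl

lemma betaLin_mul (x y : SSym k) :
    betaLin k (SSym.mul k x y) = extendBilin k biLeveledTerms (betaLin k x) (betaLin k y) := by
  rw [ssymMul_eq]
  exact lmapDomain_extendBilin k map_beta_orderedTerms x y

lemma betaLin_surjective : Function.Surjective (betaLin k) :=
  Finsupp.mapDomain_surjective beta_surjective

/-- All three factors are lifted along `betaLin`, which is surjective and multiplicative, so the
identity is inherited from `SSym`. -/
lemma extendBilin_biLeveledTerms_assoc (x y z : MSymOne k) :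
    extendBilin k biLeveledTerms (extendBilin k biLeveledTerms x y) z =
      extendBilin k biLeveledTerms x (extendBilin k biLeveledTerms y z) := by
  obtain ⟨x, rfl⟩ := betaLin_surjective k x
  obtain ⟨y, rfl⟩ := betaLin_surjective k y
  obtain ⟨z, rfl⟩ := betaLin_surjective k z
  simp only [← betaLin_mul, ssymMul_eq, extendBilin_assoc k orderedTerms_assoc]

lemma extendBilin_biLeveledTerms_unit_left (x : MSymOne k) :
    extendBilin k biLeveledTerms (MSymOne.unit k) x = x := by
  have : extendBilin k biLeveledTerms (MSymOne.unit k) = LinearMap.id := by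
    ext a : 2
    simp [MSymOne.unit, extendBilin_single, biLeveledTerms_nil_left, formalSum]
  rw [this, LinearMap.id_apply]

lemma extendBilin_biLeveledTerms_unit_right (x : MSymOne k) :
    extendBilin k biLeveledTerms x (MSymOne.unit k) = x := by
  have : (extendBilin k biLeveledTerms).flip (MSymOne.unit k) = LinearMap.id := by
    ext a : 2
    simp [MSymOne.unit, extendBilin_single, biLeveledTerms_nil_right, formalSum]
  rw [← LinearMap.flip_apply, this, LinearMap.id_apply]

/-- Grafting onto `s` keeps all nodes of `s`, so `MSym` is a left ideal. This yields both its
stability under the action and its closure under the product. -/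
lemma extendBilin_biLeveledTerms_mem (x : MSymOne k) {m : MSymOne k} (hm : m ∈ MSym k) :
    extendBilin k biLeveledTerms x m ∈ MSym k := by
  unfold MSym at hm
  rw [Finsupp.supported_eq_span_single] at hm
  induction hm using Submodule.span_induction with
  | zero => simp
  | add y z _ _ hy hz => rw [map_add]; exact add_mem hy hz
  | smul c y _ hy => rw [map_smul]; exact Submodule.smul_mem _ c hy
  | mem y hy =>
    obtain ⟨s, hs, rfl⟩ := hy
    induction x using Finsupp.induction_linear with
    | zero => simp
    | add x y hx hy => rw [map_add, LinearMap.add_apply]; exact add_mem hx hy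
    | single b c =>
      rw [← mul_one c, ← smul_eq_mul, ← Finsupp.smul_single, map_smul, LinearMap.smul_apply,
        extendBilin_single]
      refine Submodule.smul_mem _ c (list_sum_mem fun y hy => ?_)
      obtain ⟨u, hu, rfl⟩ := List.mem_map.1 hy
      exact Finsupp.single_mem_supported k 1 (numNodes_pos_of_mem_biLeveledTerms hs hu)

lemma phiLin_comp_betaLin : phiLin k ∘ₗ betaLin k = tauLin k := by
  have : phi ∘ beta = tau := by
    funext t
    simp only [Function.comp_apply, phi, beta, tau, map_comp_map]
  rw [phiLin, betaLin, tauLin, ← Finsupp.lmapDomain_comp, this]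

end Products

end MSymDefs

theorem theorem1 (k : Type*) [Field k] [CharZero k] :
    -- the action restricts to `MSym`, and it is associative and unital
    (∀ (x : MSymDefs.SSym k) (m : MSymDefs.MSymOne k),
      m ∈ MSymDefs.MSym k → MSymDefs.act k x m ∈ MSymDefs.MSym k) ∧
    (∀ (x y : MSymDefs.SSym k) (m : MSymDefs.MSymOne k),
      MSymDefs.act k (MSymDefs.SSym.mul k x y) m = MSymDefs.act k x (MSymDefs.act k y m)) ∧
    (∀ m : MSymDefs.MSymOne k, MSymDefs.act k (MSymDefs.SSym.unit k) m = m) ∧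
    -- `β` has a section, and all sections induce the same product
    (∃ g : MSymDefs.BiTree → MSymDefs.OrderedTree, Function.RightInverse g MSymDefs.beta) ∧
    (∀ g g' : MSymDefs.BiTree → MSymDefs.OrderedTree,
      Function.RightInverse g MSymDefs.beta → Function.RightInverse g' MSymDefs.beta →
      MSymDefs.MSymOne.mul k g = MSymDefs.MSymOne.mul k g') ∧
    -- the product restricts to `MSym`, it is associative and unital, and `β` is an algebra map
    (∀ g : MSymDefs.BiTree → MSymDefs.OrderedTree, Function.RightInverse g MSymDefs.beta →
      (∀ x y : MSymDefs.MSymOne k, x ∈ MSymDefs.MSym k → y ∈ MSymDefs.MSym k →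
        MSymDefs.MSymOne.mul k g x y ∈ MSymDefs.MSym k) ∧
      (∀ x y z : MSymDefs.MSymOne k,
        MSymDefs.MSymOne.mul k g (MSymDefs.MSymOne.mul k g x y) z =
          MSymDefs.MSymOne.mul k g x (MSymDefs.MSymOne.mul k g y z)) ∧
      (∀ x : MSymDefs.MSymOne k,
        MSymDefs.MSymOne.mul k g (MSymDefs.MSymOne.unit k) x = x ∧
        MSymDefs.MSymOne.mul k g x (MSymDefs.MSymOne.unit k) = x) ∧
      MSymDefs.betaLin k (MSymDefs.SSym.unit k) = MSymDefs.MSymOne.unit k ∧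
      (∀ x y : MSymDefs.SSym k,
        MSymDefs.betaLin k (MSymDefs.SSym.mul k x y) =
          MSymDefs.MSymOne.mul k g (MSymDefs.betaLin k x) (MSymDefs.betaLin k y))) ∧
    -- `β` factors `τ`
    MSymDefs.phiLin k ∘ₗ MSymDefs.betaLin k = MSymDefs.tauLin k := by
  simp only [MSymDefs.act_eq]
  refine ⟨fun x m => MSymDefs.extendBilin_biLeveledTerms_mem k _, fun x y m => ?_, fun m => ?_,
    MSymDefs.beta_surjective.hasRightInverse, fun g g' hg hg' => ?_, fun g hg => ?_,
    MSymDefs.phiLin_comp_betaLin k⟩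
  · rw [MSymDefs.betaLin_mul, MSymDefs.extendBilin_biLeveledTerms_assoc]
  · rw [MSymDefs.betaLin_unit, MSymDefs.extendBilin_biLeveledTerms_unit_left]
  · rw [MSymDefs.msymMul_eq k hg, MSymDefs.msymMul_eq k hg']
  · rw [MSymDefs.msymMul_eq k hg]
    exact ⟨fun x _ _ => MSymDefs.extendBilin_biLeveledTerms_mem k x,
      MSymDefs.extendBilin_biLeveledTerms_assoc k,
      fun x => ⟨MSymDefs.extendBilin_biLeveledTerms_unit_left k x,
        MSymDefs.extendBilin_biLeveledTerms_unit_right k x⟩,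
      MSymDefs.betaLin_unit k, MSymDefs.betaLin_mul k⟩
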